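/- Let $F$ be a field, $d\ge 0$ and $n_1,\dots,n_d\ge 0$, and let $G=[n_1]\times\dots\times[n_d]$ with the product order, where $[m]=\{0\le 1\le\dots\le m\}$. Let $\mathrm{Seg}(G)=\{(p,q)\in G\times G: p\le q\}$. *Rank-exact side.* Let $\mathrm{Rep}(G)$ be the category of functors $M$ from $G$ to $F$-vector spaces of finite total dimension, with rank invariant $\mathrm{Rk}\,M\in\mathbb Z^{\mathrm{Seg}(G)}$, $(\mathrm{Rk}\,M)(p,q)=\operatorname{rank}(M_p\to M_q)$. Let $K_0(\mathrm{Rep}(G)_{\mathrm{Rk}})$ be the abelian group generated by the objects $M$ of $\mathrm{Rep}(G)$, subject to $[M]=[M']+[M'']$ for every short exact sequence $0\to M'\to M\to M''\to 0$ with $\mathrm{Rk}\,M=\mathrm{Rk}\,M'+\mathrm{Rk}\,M''$. *Cubical side.* Let $X(G)$ be the box $\prod_k[0,n_k]\subset\mathbb R^d$, cubulated by the integer grid. Its strata are indexed by $S=\prod_k \mathrm{spine}(n_k)$, where $\mathrm{spine}(m)$ consists of the vertices $i$ ($0\le i\le m$), with source and target $s(i)=t(i)=i$, and the edges $\{i,i+1\}$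 ($0\le i<m$), with source $i$ and target $i+1$. Let $\mathrm{Ent}_\Delta(X(G))$ be the category whose objects are the strata, with a unique morphism $\sigma\to\tau$ when $\tau$ is a face of $\sigma$ and none otherwise. Let $\mathrm{pMod}^{\mathrm{Vect}}(X(G))$ be the category of functors from $\mathrm{Ent}_\Delta(X(G))$ to finite-dimensional $F$-vector spaces, and $K_0(\mathrm{pMod}^{\mathrm{Vect}}(X(G)))$ its Grothendieck group with respect to all short exact sequences. Then: 1. The map $\iota\colon S\to\mathrm{Seg}(G)$, $\iota(\alpha_1,\dots,\alpha_d)=\big((s(\alpha_1),\dots,s(\alpha_d)),(t(\alpha_1),\dots,t(\alpha_d))\big)$, is injective. 2. $[M]\mapsto \mathrm{Rk}\,M$ defines an isomorphism $\mathrm{Rk}\colon K_0(\mathrm{Rep}(G)_{\mathrm{Rk}})\cong\mathbb Z^{\mathrm{Seg}(G)}$, and $[N]\mapsto(\dim_F N(\sigma))_{\sigma\in S}$ defines an isomorphism $\dim\colon K_0(\mathrm{pMod}^{\mathrm{Vect}}(X(G)))\cong\mathbb Z^{S}$. 3. Under these isomorphisms $\iota$ induces a projection: there is a surjective group homomorphism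 $\pi\colon K_0(\mathrm{Rep}(G)_{\mathrm{Rk}})\to K_0(\mathrm{pMod}^{\mathrm{Vect}}(X(G)))$ such that $\dim(\pi(x))=\mathrm{Rk}(x)\circ\iota$ for all $x$, that is, $\pi$ corresponds to the coordinate projection $\iota^*\colon\mathbb Z^{\mathrm{Seg}(G)}\to\mathbb Z^{S}$. -/

import Mathlib

open CategoryTheory CategoryTheory.Limits

universe u v w

namespace GridK

/-! ### Grothendieck groups -/

section GrothendieckGroup

variable {C : Type w} [Category.{v} C] [HasZeroMorphisms C]

/-- The relations `[X₂] - [X₁] - [X₃]`, one for each sequence `X₁ ⟶ X₂ ⟶ X₃` in the class `E`. -/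
def k0Relations (E : ObjectProperty (ShortComplex C)) : AddSubgroup (FreeAbelianGroup C) :=
  AddSubgroup.closure {x | ∃ S : ShortComplex C, E S ∧
    x = FreeAbelianGroup.of S.X₂ - FreeAbelianGroup.of S.X₁ - FreeAbelianGroup.of S.X₃}

/-- The Grothendieck group `K₀` of a category `C` equipped with a class `E` of distinguished
sequences (its conflations, or cofibre sequences): the abelian group generated by the objects,
subject to `[X₂] = [X₁] + [X₃]` for every `X₁ ⟶ X₂ ⟶ X₃` in `E`.  In the cases used below
`0 ⟶ X ⟶ Y` and `X ⟶ Y ⟶ 0` lie in `E` whenever `X ≅ Y`, so isomorphic objects have the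
same class. -/
abbrev K0 (E : ObjectProperty (ShortComplex C)) : Type w :=
  FreeAbelianGroup C ⧸ k0Relations E

/-- The class `[X]` of an object in `K₀`. -/
def K0.cls (E : ObjectProperty (ShortComplex C)) (X : C) : K0 E :=
  QuotientAddGroup.mk (FreeAbelianGroup.of X)

end GrothendieckGroup

/-! ### Rank-exact representations of a poset -/

section RankExact

variable (F : Type u) [Field F] (P : Type) [PartialOrder P]

/-- `Seg(P)`: the pairs `(p, q)` with `p ≤ q`. -/
def Seg : Type := {s : P × P // s.1 ≤ s.2}

/-- A functor from `P` to finite-dimensional vector spaces has finite total rank when the sum of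
its dimensions is finite, that is, when only finitely many of its values are nonzero. -/
def finiteTotalRank : ObjectProperty (P ⥤ FGModuleCat.{u} F) :=
  fun M => {p : P | Nontrivial (M.obj p)}.Finite

/-- `Rep(P)`: functors from `P` to vector spaces over `F`, of finite total rank. -/
abbrev Rep : Type (u + 1) := (finiteTotalRank F P).FullSubcategory

variable {F P}

/-- The rank invariant of `M`: it sends a segment `(p, q)` to the rank of `M p ⟶ M q`. -/
noncomputable def rk (M : Rep F P) (s : Seg P) : ℤ :=
  (Module.finrank F (LinearMap.range (M.obj.map (homOfLE s.2)).hom.hom) : ℤ)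

variable (F P)

/-- The rank-exact sequences in `Rep(P)`: short exact sequences `0 ⟶ M₁ ⟶ M₂ ⟶ M₃ ⟶ 0`
along which the rank invariant is additive. -/
def rankExact : ObjectProperty (ShortComplex (Rep F P)) := fun S =>
  (S.map (finiteTotalRank F P).ι).ShortExact ∧ rk S.X₂ = rk S.X₁ + rk S.X₃

/-- `K₀(Rep(P)_Rk)`. -/
abbrev K0Rk : Type (u + 1) := K0 (rankExact F P)

end RankExact

/-! ### Grids and their cubical manifolds -/

section Grid

/-- The spine of the `n`-simplex with vertices `0, …, n`: its vertices `i` together with its edges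
from `i` to `i + 1`. -/
inductive Spine (n : ℕ) : Type
  | vertex (i : Fin (n + 1)) : Spine n
  | edge (i : Fin n) : Spine n

/-- The source (smallest vertex) of a simplex of the spine. -/
def Spine.source {n : ℕ} : Spine n → Fin (n + 1)
  | vertex i => i
  | edge i => i.castSucc

/-- The target (largest vertex) of a simplex of the spine. -/
def Spine.target {n : ℕ} : Spine n → Fin (n + 1)
  | vertex i => i
  | edge i => i.succ

theorem Spine.source_le_target {n : ℕ} (α : Spine n) : α.source ≤ α.target := by
  cases α with
  | vertex i => exact le_rfl
  | edge i => exact Fin.castSucc_lt_succ.le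

variable {d : ℕ} (n : Fin d → ℕ)

/-- The finite grid `[n₁] × ⋯ × [n_d]`, where `[m] = {0 ≤ 1 ≤ ⋯ ≤ m}`, with the product order. -/
def Grid : Type := ∀ k, Fin (n k + 1)

instance : PartialOrder (Grid n) := inferInstanceAs (PartialOrder (∀ k, Fin (n k + 1)))

/-- The strata (equivalently, the closed cubes) of the cubical grid manifold `X(G)`, that is, of
the box `∏ [0, n_k]` in `ℝ^d` cut up by the integer grid: they are the products of simplices of
the spines. -/
def Stratum : Type := ∀ k, Spine (n k)

variable {n}

/-- The closed cube of the cubulation of `X(G)` whose relative interior is the stratum `σ`. -/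
def closedCube (σ : Stratum n) : Set (Fin d → ℝ) :=
  Set.univ.pi fun k => Set.Icc (((σ k).source : ℕ) : ℝ) (((σ k).target : ℕ) : ℝ)

/-- The face order: `τ ≤ σ` when the cube of `τ` is a face of the cube of `σ`. -/
instance : Preorder (Stratum n) := Preorder.lift closedCube

variable (n) in
/-- The closed cubes cover the box `X(G) = ∏ [0, n_k]`, and nothing else. -/
theorem iUnion_closedCube :
    ⋃ σ : Stratum n, closedCube σ = Set.univ.pi fun k => Set.Icc (0 : ℝ) (n k) := by
  ext x
  simp only [closedCube, Set.mem_iUnion, Set.mem_pi, Set.mem_univ, true_implies, Set.mem_Icc]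
  constructor
  · rintro ⟨σ, h⟩ k
    refine ⟨le_trans (Nat.cast_nonneg _) (h k).1, le_trans (h k).2 ?_⟩
    exact_mod_cast Nat.lt_succ_iff.mp (σ k).target.2
  · intro h
    have key : ∀ k, ∃ α : Spine (n k),
        ((α.source : ℕ) : ℝ) ≤ x k ∧ x k ≤ ((α.target : ℕ) : ℝ) := by
      intro k
      obtain ⟨h0, h1⟩ := h k
      rcases h1.lt_or_eq with h2 | h2
      · have hf : ⌊x k⌋₊ < n k := (Nat.floor_lt h0).2 h2
        refine ⟨.edge ⟨⌊x k⌋₊, hf⟩, ?_, ?_⟩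
        · simpa [Spine.source] using Nat.floor_le h0
        · simpa [Spine.target] using (Nat.lt_floor_add_one (x k)).le
      · refine ⟨.vertex (Fin.last _), ?_, ?_⟩ <;> simp [Spine.source, Spine.target, h2]
    choose σ hσ using key
    exact ⟨σ, hσ⟩

/-- The face order in coordinates. -/
theorem stratum_le_iff (τ σ : Stratum n) :
    τ ≤ σ ↔ ∀ k, (σ k).source ≤ (τ k).source ∧ (τ k).target ≤ (σ k).target := by
  have hne : ∀ k, (((τ k).source : ℕ) : ℝ) ≤ (((τ k).target : ℕ) : ℝ) := fun k => by
    exact_mod_cast (τ k).source_le_target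
  change closedCube τ ⊆ closedCube σ ↔ _
  constructor
  · intro h k
    have h1 := h (a := fun k => (((τ k).source : ℕ) : ℝ)) (fun k _ => ⟨le_rfl, hne k⟩)
      k (Set.mem_univ k)
    have h2 := h (a := fun k => (((τ k).target : ℕ) : ℝ)) (fun k _ => ⟨hne k, le_rfl⟩)
      k (Set.mem_univ k)
    exact ⟨Fin.le_def.2 (Nat.cast_le.1 h1.1), Fin.le_def.2 (Nat.cast_le.1 h2.2)⟩
  · intro h
    refine Set.pi_mono fun k _ => Set.Icc_subset_Icc ?_ ?_
    · exact_mod_cast (h k).1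
    · exact_mod_cast (h k).2

/-- The map `ι`, sending a product of spine simplices to its segment of sources and targets. -/
def iota (α : Stratum n) : Seg (Grid n) :=
  ⟨(fun k => (α k).source, fun k => (α k).target), fun k => (α k).source_le_target⟩

variable (n)

/-- The combinatorial entrance path category of `X(G)`: its objects are the strata, and there is a
(unique) morphism `σ ⟶ τ` exactly when `τ` is a face of `σ`. -/
abbrev Ent : Type := (Stratum n)ᵒᵈ

/-- `V`-valued persistence modules parametrized by `X(G)`. -/
abbrev PMod (V : Type w) [Category.{v} V] : Type _ := Ent n ⥤ V

variable (F : Type u) [Field F]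

/-- `K₀` of the category of persistence modules on `X(G)` valued in finite-dimensional vector
spaces over `F`.  The cofibre sequences are all short exact sequences. -/
abbrev K0PMod : Type (u + 1) :=
  K0 (fun S : ShortComplex (PMod n (FGModuleCat.{u} F)) => S.ShortExact)

end Grid

end GridK

/-!
Both isomorphisms are instances of one generation principle. In an abelian category `C` over `F`,
let `L i` (`i` in a finite set) be objects with `End (L i) = F`, with finite-dimensional spaces
`Hom(L i, M)`, such that nonzero morphisms between different `L i` lower a degree `r i`, and such
that the functors `Hom(L i, -)` are jointly faithful. Call a short exact sequence relatively exact
if all `dim Hom(L i, -)` are additive on it. Then the class of any `M` in the Grothendieck group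
of the relatively exact sequences is a combination of the classes of the `L i`
(`IsRelAdditive.mem_closure`): the sum `R` of the objects `L i ⊗ Hom(L i, M)` covers `M` by a
relatively exact sequence `0 ⟶ K ⟶ R ⟶ M ⟶ 0`, and if `Hom(L i, M)` vanishes for `r i < k`, then
`Hom(L i, K)` vanishes for `r i < k + 1` (`exists_cover`), so that after finitely many steps
nothing is left.

For a finite poset `P` the objects `L s` are the hooks, indexed by the segments `s = (p, q)`: for
`p < q` the cokernel of the map `P_q ⟶ P_p` of projectives, and `P_p` itself for `p = q`. Morphisms
from the hook to `M` are the elements of `ker (M p ⟶ M q)`, respectively of `M p`. Therefore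
additivity of the rank invariant is the same as additivity of all `dim Hom(L s, -)`
(`rk_eq_sub`), and the relatively exact sequences are the rank-exact ones. Using only the hooks
`P_p`, every short exact sequence is relatively exact, and the principle applies to the modules on
the face poset of the cubulation.

In both cases the group has as many generators as there are coordinates of the invariant, and the
invariant is onto: the rank invariants of segment modules are unitriangular (`closure_range_rk`),
and the simple modules have the unit vectors as dimension vectors. A surjection `ℤ^κ → A` followed
by a surjection `A → ℤ^κ` is an isomorphism, hence so is each of the two
(`bijective_of_closure_range_eq_top`). The projection is then the restriction of functions along
the injection `iota`.
-/

namespace GridK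

/-! ### Generation of relative Grothendieck groups by exceptional families -/

section Exceptional

open scoped ZeroObject

variable {C : Type w} [Category.{v} C] [Abelian C] {F : Type u} [Field F] [Linear F C]

theorem finrank_hom_of_shortExact {S : ShortComplex C} (hS : S.ShortExact) (X : C)
    [∀ Y : C, Module.Finite F (X ⟶ Y)]
    (hsurj : ∀ φ : X ⟶ S.X₃, ∃ ψ : X ⟶ S.X₂, ψ ≫ S.g = φ) :
    Module.finrank F (X ⟶ S.X₂) = Module.finrank F (X ⟶ S.X₁) + Module.finrank F (X ⟶ S.X₃) := by
  have := hS.mono_f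
  have hinj : Function.Injective (Linear.rightComp F X S.f) := fun a b h => by
    simpa [cancel_mono] using h
  have hker : LinearMap.ker (Linear.rightComp F X S.g) =
      LinearMap.range (Linear.rightComp F X S.f) := by
    ext φ
    simp only [LinearMap.mem_ker, LinearMap.mem_range, Linear.rightComp_apply]
    refine ⟨fun h => ⟨hS.exact.lift φ h, hS.exact.lift_f φ h⟩, ?_⟩
    rintro ⟨ψ, rfl⟩
    simp
  have hrange : LinearMap.range (Linear.rightComp F X S.g) = ⊤ :=
    LinearMap.range_eq_top.2 hsurj
  rw [← LinearMap.finrank_range_add_finrank_ker (Linear.rightComp F X S.g), hker, hrange,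
    finrank_top, LinearMap.finrank_range_of_inj hinj, add_comm]

/-- A function on objects which is additive on the short exact sequences along which
`dim Hom(L i, -)` is additive for all `i`. -/
def IsRelAdditive (F : Type u) [Field F] [Linear F C] {ι : Type*} (L : ι → C) {A : Type*}
    [AddCommGroup A] (cls : C → A) : Prop :=
  ∀ S : ShortComplex C, S.ShortExact →
    (∀ i, Module.finrank F (L i ⟶ S.X₂) =
      Module.finrank F (L i ⟶ S.X₁) + Module.finrank F (L i ⟶ S.X₃)) →
    cls S.X₂ = cls S.X₁ + cls S.X₃

variable {ι : Type*} {L : ι → C} {A : Type*} [AddCommGroup A] {cls : C → A}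

theorem IsRelAdditive.of_splitting [∀ i (M : C), Module.Finite F (L i ⟶ M)]
    (h : IsRelAdditive F L cls) {S : ShortComplex C} (s : S.Splitting) :
    cls S.X₂ = cls S.X₁ + cls S.X₃ :=
  h S s.shortExact fun i =>
    finrank_hom_of_shortExact s.shortExact (L i) fun φ => ⟨φ ≫ s.s, by simp⟩

theorem IsRelAdditive.of_isZero [∀ i (M : C), Module.Finite F (L i ⟶ M)]
    (h : IsRelAdditive F L cls) {X : C} (hX : IsZero X) : cls X = 0 := by
  have := h.of_splitting (S := ShortComplex.mk (0 : X ⟶ X) (0 : X ⟶ X) (by simp))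
    { r := 0
      s := 0
      f_r := hX.eq_of_src _ _
      s_g := hX.eq_of_src _ _
      id := hX.eq_of_src _ _ }
  simpa using this

theorem IsRelAdditive.of_iso [∀ i (M : C), Module.Finite F (L i ⟶ M)]
    (h : IsRelAdditive F L cls) {X Y : C} (e : X ≅ Y) : cls X = cls Y := by
  have := h.of_splitting (S := ShortComplex.mk (0 : 0 ⟶ X) e.hom (by simp))
    { r := 0
      s := e.inv
      f_r := (isZero_zero C).eq_of_src _ _
      s_g := by simp
      id := by simp }
  simpa [h.of_isZero (isZero_zero C)] using this

/-- Induction on the number of summands, splitting off one summand at a time. -/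
theorem IsRelAdditive.biproduct_mem [HasFiniteBiproducts C] [∀ i (M : C), Module.Finite F (L i ⟶ M)]
    (h : IsRelAdditive F L cls) (B : AddSubgroup A) {J : Type} [Finite J] :
    ∀ f : J → C, (∀ j, cls (f j) ∈ B) → cls (⨁ f) ∈ B := by
  suffices H : ∀ [HasBiproductsOfShape J C] (f : J → C), (∀ j, cls (f j) ∈ B) →
      cls (⨁ f) ∈ B from H
  induction J using Finite.induction_empty_option with
  | of_equiv e ih =>
    intro _ f hf
    have := hasBiproductsOfShape_of_equiv C e
    rw [← h.of_iso (biproduct.whiskerEquiv (f := fun j => f (e j)) e fun j => Iso.refl _)]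
    exact ih _ fun j => hf _
  | h_empty =>
    intro _ f hf
    rw [h.of_isZero]
    · exact B.zero_mem
    · rw [IsZero.iff_id_eq_zero]
      exact biproduct.hom_ext _ _ fun j => j.elim
  | h_option ih =>
    rename_i J _
    intro _ f hf
    classical
    have hne : ∀ a : J, biproduct.ι f (some a) ≫ biproduct.π f none = 0 := fun a =>
      biproduct.ι_π_ne _ (by simp)
    have hs := h.of_splitting (S := ShortComplex.mk
      (biproduct.desc fun a => biproduct.ι f (some a) :
        (⨁ fun a => f (some a)) ⟶ ⨁ f) (biproduct.π f none)
        (biproduct.hom_ext' _ _ fun a => by simp [hne]))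
      { r := biproduct.lift fun a => biproduct.π f (some a)
        s := biproduct.ι f none
        f_r := by
          refine biproduct.hom_ext' _ _ fun a => biproduct.hom_ext _ _ fun b => ?_
          by_cases hab : a = b
          · subst hab; simp
          · simp [biproduct.ι_π_ne _ hab, biproduct.ι_π_ne f (fun h => hab (Option.some.inj h))]
        s_g := by simp
        id := by
          rw [← biproduct.total, Fintype.sum_option, biproduct.lift_desc, add_comm] }
    rw [hs]
    exact B.add_mem (ih _ fun a => hf _) (hf none)

variable [Finite ι]

/-- The covering step: if `Hom(L i, M)` vanishes in degrees below `k`, then `M` is a relative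
quotient of a sum of objects `L i`, with a kernel whose `Hom(L i, -)` also vanish in degree `k`. -/
theorem exists_cover [hfin : ∀ i (M : C), Module.Finite F (L i ⟶ M)] (r : ι → ℕ)
    (hend : ∀ i (φ : L i ⟶ L i), ∃ c : F, φ = c • 𝟙 (L i))
    (hhom : ∀ i j, i ≠ j → r i ≤ r j → ∀ φ : L i ⟶ L j, φ = 0)
    (hsep : ∀ {M N : C} (g : M ⟶ N), (∀ i (φ : L i ⟶ M), φ ≫ g = 0) → g = 0)
    (h : IsRelAdditive F L cls) {k : ℕ} {M : C}
    (hM : ∀ i, r i < k → ∀ φ : L i ⟶ M, φ = 0) :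
    ∃ R K : C, cls R ∈ AddSubgroup.closure (Set.range fun i => cls (L i)) ∧
      cls R = cls K + cls M ∧ ∀ i, r i < k + 1 → ∀ φ : L i ⟶ K, φ = 0 := by
  classical
  have : HasFiniteBiproducts C := Abelian.hasFiniteBiproducts
  obtain ⟨m, ⟨e⟩⟩ := Finite.exists_equiv_fin ι
  -- The index set is moved to `Fin m` because finite biproducts are indexed by types in `Type`.
  let b := fun i => Module.finBasis F (L i ⟶ M)
  let J : Type := Σ a : Fin m, Fin (Module.finrank F (L (e.symm a) ⟶ M))
  let G : J → C := fun j => L (e.symm j.1)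
  let f : ⨁ G ⟶ M := biproduct.desc fun j => b (e.symm j.1) j.2
  have hlift : ∀ i (φ : L i ⟶ M), ∃ ψ : L i ⟶ ⨁ G, ψ ≫ f = φ := by
    intro i
    obtain ⟨a, rfl⟩ := e.symm.surjective i
    intro φ
    refine ⟨∑ x, (b (e.symm a)).repr φ x • biproduct.ι G ⟨a, x⟩, ?_⟩
    simp only [Preadditive.sum_comp, Linear.smul_comp, f, biproduct.ι_desc]
    exact (b (e.symm a)).sum_repr φ
  have hepi : Epi f := by
    refine Preadditive.epi_of_cancel_zero f fun g hg => hsep g fun i φ => ?_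
    obtain ⟨ψ, rfl⟩ := hlift i φ
    rw [Category.assoc, hg, comp_zero]
  have hSE : (ShortComplex.mk (kernel.ι f) f (kernel.condition f)).ShortExact :=
    { exact := ShortComplex.exact_kernel f }
  refine ⟨⨁ G, kernel f, ?_, ?_, ?_⟩
  · exact h.biproduct_mem _ G fun j => AddSubgroup.subset_closure ⟨_, rfl⟩
  · exact h _ hSE fun i => finrank_hom_of_shortExact hSE (L i) (hlift i)
  · intro i
    obtain ⟨a, rfl⟩ := e.symm.surjective i
    intro hi φ
    rw [← cancel_mono (kernel.ι f), zero_comp]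
    have hf0 : (φ ≫ kernel.ι f) ≫ f = 0 := by simp
    generalize φ ≫ kernel.ι f = ψ at hf0
    -- Only the copies of `L i` itself, at index `a`, can receive a nonzero component of `ψ`:
    -- nonzero maps to other `L t` go down in degree, where `Hom(L t, M)` vanishes and `L t` is
    -- no summand of the cover.
    have hz : ∀ j : J, j.1 ≠ a → ψ ≫ biproduct.π G j = 0 := by
      intro j hj
      by_cases hr : r (e.symm a) ≤ r (e.symm j.1)
      · exact hhom _ _ (fun h' => hj (e.symm.injective h').symm) hr _
      · have hb : b (e.symm j.1) j.2 = 0 := hM _ (by omega) _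
        exact absurd hb ((b _).ne_zero _)
    -- The components in the copies of `L i` are scalars, which `f` turns into the coefficients of a
    -- linear combination of basis vectors of `Hom(L i, M)`.
    choose c hc using fun x => hend (e.symm a) (ψ ≫ biproduct.π G ⟨a, x⟩)
    have hsum : ψ ≫ f = ∑ x, c x • b (e.symm a) x := by
      have : ψ ≫ f = ∑ j : J, (ψ ≫ biproduct.π G j) ≫ b (e.symm j.1) j.2 := by
        simp only [f, Category.assoc, ← Preadditive.comp_sum]
        congr 1
        exact biproduct.hom_ext' _ _ fun j => by
          rw [biproduct.ι_desc, Preadditive.comp_sum, Finset.sum_eq_single j]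
          · simp
          · intro j' _ hj'
            rw [biproduct.ι_π_ne_assoc _ hj'.symm, zero_comp]
          · simp
      rw [this, Fintype.sum_sigma, Finset.sum_eq_single a]
      · refine Finset.sum_congr rfl fun x _ => ?_
        rw [hc]
        simp
      · intro a' _ ha'
        exact Finset.sum_eq_zero fun x _ => by rw [hz ⟨a', x⟩ ha', zero_comp]
      · simp
    have hc0 : ∀ x, c x = 0 :=
      Fintype.linearIndependent_iff.1 (b (e.symm a)).linearIndependent c (hsum ▸ hf0)
    refine biproduct.hom_ext _ _ fun j => ?_
    rw [zero_comp]
    by_cases hj : j.1 = a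
    · obtain ⟨a', x⟩ := j
      obtain rfl : a' = a := hj
      rw [hc, hc0, zero_smul]
    · exact hz j hj

/-- Iterating `exists_cover` up to the largest degree, a relatively additive invariant takes its
values in the subgroup generated by its values on the objects `L i`. -/
theorem IsRelAdditive.mem_closure [hfin : ∀ i (M : C), Module.Finite F (L i ⟶ M)] (r : ι → ℕ)
    (hend : ∀ i (φ : L i ⟶ L i), ∃ c : F, φ = c • 𝟙 (L i))
    (hhom : ∀ i j, i ≠ j → r i ≤ r j → ∀ φ : L i ⟶ L j, φ = 0)
    (hsep : ∀ {M N : C} (g : M ⟶ N), (∀ i (φ : L i ⟶ M), φ ≫ g = 0) → g = 0)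
    (h : IsRelAdditive F L cls) (M : C) :
    cls M ∈ AddSubgroup.closure (Set.range fun i => cls (L i)) := by
  obtain ⟨N, hN⟩ := (Set.finite_range r).bddAbove
  suffices H : ∀ k ≤ N + 1, ∀ M : C, (∀ i, r i < k → ∀ φ : L i ⟶ M, φ = 0) →
      cls M ∈ AddSubgroup.closure (Set.range fun i => cls (L i)) from
    H 0 (Nat.zero_le _) M fun i hi => absurd hi (Nat.not_lt_zero _)
  intro k hk
  induction hk using Nat.decreasingInduction with
  | self =>
    intro M hM
    have h0 : 𝟙 M = 0 := hsep _ fun i φ => by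
      rw [hM i (Nat.lt_succ_of_le (hN ⟨i, rfl⟩)) φ, zero_comp]
    rw [h.of_isZero ((IsZero.iff_id_eq_zero M).2 h0)]
    exact AddSubgroup.zero_mem _
  | of_succ k hk ih =>
    intro M hM
    obtain ⟨R, K, hR, hRK, hK⟩ := exists_cover r hend hhom hsep h hM
    rw [show cls M = cls R - cls K by rw [hRK, add_sub_cancel_left]]
    exact AddSubgroup.sub_mem _ hR (ih K hK)

end Exceptional

/-! ### Homomorphisms out of Grothendieck groups -/

section Generators

variable {C : Type w} [Category.{v} C] [HasZeroMorphisms C] (E : ObjectProperty (ShortComplex C))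

theorem K0.cls_add {S : ShortComplex C} (hS : E S) :
    K0.cls E S.X₂ = K0.cls E S.X₁ + K0.cls E S.X₃ := by
  have h : FreeAbelianGroup.of S.X₂ - FreeAbelianGroup.of S.X₁ - FreeAbelianGroup.of S.X₃ ∈
      k0Relations E := AddSubgroup.subset_closure ⟨S, hS, rfl⟩
  have := (QuotientAddGroup.eq_zero_iff _).2 h
  rw [QuotientAddGroup.mk_sub, QuotientAddGroup.mk_sub, sub_sub, sub_eq_zero] at this
  exact this

/-- The homomorphism out of `K₀` given by a function on objects which is additive on the
distinguished sequences. -/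
def K0.lift {A : Type*} [AddCommGroup A] (f : C → A)
    (hf : ∀ S : ShortComplex C, E S → f S.X₂ = f S.X₁ + f S.X₃) : K0 E →+ A :=
  QuotientAddGroup.lift _ (FreeAbelianGroup.lift f) <| by
    rw [k0Relations, AddSubgroup.closure_le]
    rintro _ ⟨S, hS, rfl⟩
    simp [hf S hS, sub_sub]

theorem K0.lift_cls {A : Type*} [AddCommGroup A] (f : C → A)
    (hf : ∀ S : ShortComplex C, E S → f S.X₂ = f S.X₁ + f S.X₃) (X : C) :
    K0.lift E f hf (K0.cls E X) = f X :=
  FreeAbelianGroup.lift_apply_of f X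

theorem K0.eq_top_of_cls_mem {B : AddSubgroup (K0 E)} (hB : ∀ X, K0.cls E X ∈ B) : B = ⊤ := by
  refine AddSubgroup.eq_top_iff' B |>.2 fun x => ?_
  induction x using QuotientAddGroup.induction_on with
  | H x =>
    induction x using FreeAbelianGroup.induction_on with
    | zero => exact B.zero_mem
    | of X => exact hB X
    | neg X _ => exact B.neg_mem (hB X)
    | add x y hx hy => exact B.add_mem hx hy

/-- An abelian group with as many generators as the rank of a free quotient is that quotient:
the composite `ℤ^κ → A → ℤ^κ` is a surjective endomorphism of a Noetherian module, hence
injective. -/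
theorem bijective_of_closure_range_eq_top {A κ : Type*} [AddCommGroup A] [Finite κ] (v : κ → A)
    (hv : AddSubgroup.closure (Set.range v) = ⊤) (g : A →+ (κ → ℤ))
    (hg : Function.Surjective g) : Function.Bijective g := by
  have := Fintype.ofFinite κ
  have hf : Function.Surjective (Fintype.linearCombination ℤ v) := by
    rw [← LinearMap.range_eq_top, Fintype.range_linearCombination]
    refine Submodule.toAddSubgroup_injective ?_
    rw [Submodule.span_int_eq_addSubgroupClosure, hv]
    rfl
  have hinj := IsNoetherian.injective_of_surjective_endomorphism
    (g.toIntLinearMap ∘ₗ Fintype.linearCombination ℤ v) (hg.comp hf)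
  refine ⟨fun x y hxy => ?_, hg⟩
  obtain ⟨a, rfl⟩ := hf x
  obtain ⟨b, rfl⟩ := hf y
  rw [hinj hxy]

end Generators

/-! ### Indicator representations of convex sets -/

section Indicator

variable (F : Type u) [Field F] {P : Type} [PartialOrder P]

theorem map_app_apply {M N : P ⥤ FGModuleCat.{u} F} (φ : M ⟶ N) {x y : P} (h : x ⟶ y)
    (m : M.obj x) :
    (φ.app y).hom.hom ((M.map h).hom.hom m) = (N.map h).hom.hom ((φ.app x).hom.hom m) :=
  congrArg (fun f => f.hom.hom m) (φ.naturality h)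

theorem map_map_apply (M : P ⥤ FGModuleCat.{u} F) {x y z : P} (h : x ⟶ y) (h' : y ⟶ z)
    (k : x ⟶ z) (m : M.obj x) :
    (M.map h').hom.hom ((M.map h).hom.hom m) = (M.map k).hom.hom m := by
  rw [Subsingleton.elim k (h ≫ h'), M.map_comp]
  rfl

theorem map_self_apply (M : P ⥤ FGModuleCat.{u} F) {x : P} (h : x ⟶ x) (m : M.obj x) :
    (M.map h).hom.hom m = m := by
  rw [Subsingleton.elim h (𝟙 x), M.map_id]
  rfl

open Classical in
/-- The indicator representation of a convex subset `I`: it is `F` on `I` and zero elsewhere, with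
identity maps inside `I`.  Its value at `x` is encoded as the functions on the proofs of
`x ∈ I`. -/
noncomputable def indicatorRep (I : Set P) [hI : I.OrdConnected] : P ⥤ FGModuleCat.{u} F where
  obj x := FGModuleCat.of F (PLift (x ∈ I) → F)
  map {x y} _ := FGModuleCat.ofHom
    { toFun := fun f _ => if hx : x ∈ I then f ⟨hx⟩ else 0
      map_add' := fun f g => by
        funext _
        by_cases hx : x ∈ I <;> simp [hx]
      map_smul' := fun c f => by
        funext _
        by_cases hx : x ∈ I <;> simp [hx] }
  map_id x := by
    refine FGModuleCat.hom_ext (LinearMap.ext fun f => funext fun hx : PLift (x ∈ I) => ?_)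
    exact dif_pos hx.down
  map_comp {x y z} h h' := by
    refine FGModuleCat.hom_ext (LinearMap.ext fun (f : PLift (x ∈ I) → F) =>
      funext fun hz : PLift (z ∈ I) => ?_)
    change (if hx : x ∈ I then f ⟨hx⟩ else 0) =
      if _ : y ∈ I then (if hx : x ∈ I then f ⟨hx⟩ else 0) else 0
    by_cases hx : x ∈ I
    · rw [dif_pos (hI.out hx hz.down ⟨leOfHom h, leOfHom h'⟩)]
    · simp [hx]

variable (I : Set P) [I.OrdConnected]

theorem indicatorRep_map_apply {x y : P} (h : x ⟶ y) (f : PLift (x ∈ I) → F) (hx : x ∈ I)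
    (hy : PLift (y ∈ I)) :
    (show PLift (y ∈ I) → F from ((indicatorRep F I).map h).hom.hom f) hy = f ⟨hx⟩ :=
  dif_pos hx

theorem finrank_range_indicatorRep_map [DecidablePred (· ∈ I)] {x y : P} (h : x ⟶ y) :
    Module.finrank F (LinearMap.range ((indicatorRep F I).map h).hom.hom) =
      if x ∈ I ∧ y ∈ I then 1 else 0 := by
  split_ifs with hxy
  · obtain ⟨hx, hy⟩ := hxy
    have : LinearMap.range ((indicatorRep F I).map h).hom.hom = ⊤ := by
      refine LinearMap.range_eq_top.2 fun (g : PLift (y ∈ I) → F) =>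
        ⟨fun _ : PLift (x ∈ I) => g ⟨hy⟩, ?_⟩
      funext _
      exact dif_pos hx
    rw [this, finrank_top]
    have hu : Unique (PLift (y ∈ I)) := ⟨⟨⟨hy⟩⟩, fun _ => rfl⟩
    exact (Module.finrank_fintype_fun_eq_card F).trans Fintype.card_unique
  · have : ((indicatorRep F I).map h).hom.hom = 0 := by
      refine LinearMap.ext fun f => funext fun hy => dif_neg fun hx => hxy ⟨hx, hy.down⟩
    rw [this, LinearMap.range_zero, finrank_bot]

theorem finrank_indicatorRep_obj [DecidablePred (· ∈ I)] (x : P) :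
    Module.finrank F ((indicatorRep F I).obj x) = if x ∈ I then 1 else 0 := by
  have := finrank_range_indicatorRep_map F I (𝟙 x)
  rw [(indicatorRep F I).map_id, FGModuleCat.hom_hom_id, LinearMap.range_id, finrank_top] at this
  simpa only [and_self] using this

end Indicator

/-! ### Hooks -/

section Hook

variable (F : Type u) [Field F] {P : Type} [PartialOrder P]

/-- The segment from `x` to `x`. -/
def Seg.refl (x : P) : Seg P := ⟨(x, x), le_rfl⟩

instance [Finite P] : Finite (Seg P) := inferInstanceAs (Finite {s : P × P // s.1 ≤ s.2})

theorem Seg.ext' {s t : Seg P} (h₁ : s.1.1 = t.1.1) (h₂ : s.1.2 = t.1.2) : s = t :=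
  Subtype.ext (Prod.ext h₁ h₂)

/-- The support of the hook of `(p, q)`: the elements above `p` and, unless `p = q`, not
above `q`. -/
def hookSet (s : Seg P) : Set P := {x | s.1.1 ≤ x ∧ (s.1.1 ≠ s.1.2 → ¬ s.1.2 ≤ x)}

instance (s : Seg P) : (hookSet s).OrdConnected :=
  ⟨fun _ hx _ hy _ hz => ⟨hx.1.trans hz.1, fun h h' => hy.2 h (h'.trans hz.2)⟩⟩

theorem fst_mem_hookSet (s : Seg P) : s.1.1 ∈ hookSet s :=
  ⟨le_rfl, fun h h' => h (le_antisymm s.2 h')⟩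

/-- The hook of a segment `(p, q)`: for `p ≠ q` the cokernel of the map from the projective at `q`
to the projective at `p`, and for `p = q` the projective at `p`. -/
noncomputable abbrev hook (s : Seg P) : P ⥤ FGModuleCat.{u} F := indicatorRep F (hookSet s)

/-- The generator of a hook, at the start of the segment. -/
def hookGen (s : Seg P) : (hook F s).obj s.1.1 := fun _ : PLift (s.1.1 ∈ hookSet s) => (1 : F)

/-- Evaluation of morphisms out of a hook at the generator. -/
noncomputable def hookEval (s : Seg P) (M : P ⥤ FGModuleCat.{u} F) :
    (hook F s ⟶ M) →ₗ[F] M.obj s.1.1 where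
  toFun φ := (φ.app s.1.1).hom.hom (hookGen F s)
  map_add' _ _ := rfl
  map_smul' _ _ := rfl

/-- The generator generates: every vector of a hook is a multiple of a translate of it. -/
theorem eq_smul_map_hookGen (s : Seg P) {x : P} (hx : x ∈ hookSet s)
    (f : PLift (x ∈ hookSet s) → F) :
    (show (hook F s).obj x from f) =
      f ⟨hx⟩ • ((hook F s).map (homOfLE hx.1)).hom.hom (hookGen F s) := by
  funext hx'
  refine Eq.trans ?_ (congrArg (f ⟨hx⟩ * ·) (indicatorRep_map_apply F (hookSet s) (homOfLE hx.1)
    (hookGen F s) (fst_mem_hookSet s) hx').symm)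
  exact (mul_one _).symm

theorem eq_zero_of_notMem {I : Set P} [I.OrdConnected] {x : P} (hx : x ∉ I)
    (f : (indicatorRep F I).obj x) : f = 0 :=
  funext fun h : PLift (x ∈ I) => absurd h.down hx

theorem hookEval_injective (s : Seg P) (M : P ⥤ FGModuleCat.{u} F) :
    Function.Injective (hookEval F s M) := by
  rw [injective_iff_map_eq_zero]
  intro φ (hφ : (φ.app s.1.1).hom.hom (hookGen F s) = 0)
  ext x f
  change (φ.app x).hom.hom f = 0
  by_cases hx : x ∈ hookSet s
  · rw [eq_smul_map_hookGen F s hx f, map_smul, map_app_apply, hφ, map_zero, smul_zero]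
  · rw [eq_zero_of_notMem F hx f, map_zero]

open Classical in
/-- Morphisms out of the hook of `(p, q)` with `p ≠ q` are the elements of `ker (M p ⟶ M q)`, and
morphisms out of the hook of `(p, p)` are the elements of `M p`. -/
theorem range_hookEval (s : Seg P) (M : P ⥤ FGModuleCat.{u} F) (m : M.obj s.1.1) :
    m ∈ LinearMap.range (hookEval F s M) ↔
      (s.1.1 ≠ s.1.2 → (M.map (homOfLE s.2)).hom.hom m = 0) := by
  constructor
  · rintro ⟨φ, rfl⟩ hs
    change (M.map (homOfLE s.2)).hom.hom ((φ.app s.1.1).hom.hom (hookGen F s)) = 0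
    rw [← map_app_apply, eq_zero_of_notMem F (fun h => h.2 hs le_rfl)
      (((hook F s).map (homOfLE s.2)).hom.hom (hookGen F s)), map_zero]
  · intro hm
    -- The morphism sends the generator to `m`, hence every translate of it to the translate of `m`.
    let φ : ∀ x, (hook F s).obj x →ₗ[F] M.obj x := fun x =>
      if hx : x ∈ hookSet s then
        (LinearMap.proj (⟨hx⟩ : PLift (x ∈ hookSet s))).smulRight
          ((M.map (homOfLE hx.1)).hom.hom m)
      else 0
    have hφ : ∀ x (hx : x ∈ hookSet s) (f : PLift (x ∈ hookSet s) → F),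
        φ x f = f ⟨hx⟩ • (M.map (homOfLE hx.1)).hom.hom m := fun x hx f => by
      simp only [φ, dif_pos hx]
      rfl
    have hnat : ∀ {x y : P} (h : x ⟶ y) (f : (hook F s).obj x),
        φ y (((hook F s).map h).hom.hom f) = (M.map h).hom.hom (φ x f) := by
      intro x y h f
      by_cases hx : x ∈ hookSet s
      · rw [hφ x hx f, map_smul, map_map_apply F M _ h (homOfLE (hx.1.trans (leOfHom h)))]
        by_cases hy : y ∈ hookSet s
        · refine (hφ y hy _).trans (congrArg (· • _) ?_)
          exact indicatorRep_map_apply F (hookSet s) h f hx ⟨hy⟩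
        · have : s.1.1 ≠ s.1.2 ∧ s.1.2 ≤ y := by
            by_contra hcon
            exact hy ⟨hx.1.trans (leOfHom h), fun h1 h2 => hcon ⟨h1, h2⟩⟩
          rw [← map_map_apply F M (homOfLE s.2) (homOfLE this.2), hm this.1, map_zero, smul_zero,
            eq_zero_of_notMem F hy (((hook F s).map h).hom.hom f), map_zero]
      · rw [eq_zero_of_notMem F hx f, map_zero, map_zero, map_zero, map_zero]
    refine ⟨{ app := fun x => FGModuleCat.ofHom (φ x), naturality := fun x y h => ?_ }, ?_⟩
    · ext f
      exact hnat h f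
    · change φ s.1.1 (hookGen F s) = m
      refine (hφ _ (fst_mem_hookSet s) _).trans ?_
      rw [map_self_apply]
      exact one_smul F m

theorem finite_hook_hom (s : Seg P) (M : P ⥤ FGModuleCat.{u} F) :
    Module.Finite F (hook F s ⟶ M) :=
  Module.Finite.of_injective _ (hookEval_injective F s M)

theorem exists_hom_hook_refl {x : P} {M : P ⥤ FGModuleCat.{u} F} (m : M.obj x) :
    ∃ φ : hook F (Seg.refl x) ⟶ M, (φ.app x).hom.hom (hookGen F (Seg.refl x)) = m :=
  (range_hookEval F (Seg.refl x) M m).2 fun h => absurd rfl h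

theorem finrank_hook_hom_refl (x : P) (M : P ⥤ FGModuleCat.{u} F) :
    Module.finrank F (hook F (Seg.refl x) ⟶ M) = Module.finrank F (M.obj x) :=
  (LinearEquiv.ofBijective (hookEval F (Seg.refl x) M)
    ⟨hookEval_injective F _ M, exists_hom_hook_refl F⟩).finrank_eq

theorem finrank_hook_hom {s : Seg P} (hs : s.1.1 ≠ s.1.2) (M : P ⥤ FGModuleCat.{u} F) :
    Module.finrank F (hook F s ⟶ M) =
      Module.finrank F (LinearMap.ker (M.map (homOfLE s.2)).hom.hom) := by
  rw [← LinearMap.finrank_range_of_inj (hookEval_injective F s M)]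
  have : LinearMap.range (hookEval F s M) = LinearMap.ker (M.map (homOfLE s.2)).hom.hom := by
    ext m
    rw [range_hookEval, LinearMap.mem_ker]
    exact ⟨fun h => h hs, fun h _ => h⟩
  rw [this]

/-- The functors `Hom(hook (x, x), -)`, which are the evaluations at `x`, are jointly faithful. -/
theorem eq_zero_of_forall_hook_refl {M N : P ⥤ FGModuleCat.{u} F} (g : M ⟶ N)
    (hg : ∀ x (φ : hook F (Seg.refl x) ⟶ M), φ ≫ g = 0) : g = 0 := by
  ext x m
  obtain ⟨φ, rfl⟩ := exists_hom_hook_refl F (show M.obj x from m)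
  exact congrArg (fun ψ => (ψ.app x).hom.hom (hookGen F (Seg.refl x))) (hg x φ)

theorem end_hook (s : Seg P) (φ : hook F s ⟶ hook F s) : ∃ c : F, φ = c • 𝟙 (hook F s) := by
  let f : PLift (s.1.1 ∈ hookSet s) → F := (φ.app s.1.1).hom.hom (hookGen F s)
  refine ⟨f ⟨fst_mem_hookSet s⟩, hookEval_injective F s _ ?_⟩
  change f = f ⟨fst_mem_hookSet s⟩ • hookGen F s
  funext _
  exact (mul_one _).symm

/-- A degree on the hooks which nonzero morphisms between different hooks lower. A segment
`(p, p)` counts as `(p, ∞)`, which explains the summand exceeding the number of elements below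
any `q`. -/
noncomputable def hookDegree (s : Seg P) : ℕ :=
  open Classical in
  (Set.Iic s.1.1).ncard + if s.1.1 = s.1.2 then Nat.card P + 1 else (Set.Iic s.1.2).ncard

/-- A nonzero morphism from the hook of `(p, q)` to the hook of `(p', q')` forces `p' ≤ p` and
`q' ≤ q`, where the end of a segment `(p, p)` is read as `∞`. -/
theorem hook_hom_eq_zero [Finite P] {s t : Seg P} (hst : s ≠ t)
    (hdeg : hookDegree s ≤ hookDegree t) (φ : hook F s ⟶ hook F t) : φ = 0 := by
  by_contra hφ
  have hgen : hookEval F s _ φ ≠ 0 := fun h => hφ (hookEval_injective F s _ (by rw [h, map_zero]))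
  have hp : s.1.1 ∈ hookSet t := by
    by_contra hp
    exact hgen (eq_zero_of_notMem F hp _)
  have hmono : ∀ {x y : P}, x ≤ y → (Set.Iic x).ncard ≤ (Set.Iic y).ncard := fun h =>
    Set.ncard_le_ncard (Set.Iic_subset_Iic.2 h)
  have hmono' : ∀ {x y : P}, x < y → (Set.Iic x).ncard < (Set.Iic y).ncard := fun h =>
    Set.ncard_lt_ncard (Set.Iic_ssubset_Iic.2 h)
  have h1 := hmono hp.1
  have hcard : ∀ x : P, (Set.Iic x).ncard ≤ Nat.card P := fun x => Set.ncard_le_card _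
  simp only [hookDegree] at hdeg
  by_cases hs : s.1.1 = s.1.2
  · rw [if_pos hs] at hdeg
    by_cases ht : t.1.1 = t.1.2
    · rw [if_pos ht] at hdeg
      have hne : t.1.1 ≠ s.1.1 := fun h => hst (Seg.ext' h.symm (hs.symm.trans (h.symm.trans ht)))
      have := hmono' (lt_of_le_of_ne hp.1 hne)
      omega
    · rw [if_neg ht] at hdeg
      have := hcard t.1.2
      omega
  · have hq : s.1.2 ∉ hookSet t := by
      intro hq
      have h0 := (range_hookEval F s (hook F t) _).1 ⟨φ, rfl⟩ hs
      refine hgen (funext fun h : PLift (s.1.1 ∈ hookSet t) => ?_)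
      exact (indicatorRep_map_apply F (hookSet t) (homOfLE s.2) (hookEval F s _ φ) hp ⟨hq⟩).symm.trans
        (congrFun h0 (⟨hq⟩ : PLift (s.1.2 ∈ hookSet t)))
    have ht : t.1.1 ≠ t.1.2 ∧ t.1.2 ≤ s.1.2 := by
      by_contra hcon
      exact hq ⟨hp.1.trans s.2, fun h1 h2 => hcon ⟨h1, h2⟩⟩
    rw [if_neg hs, if_neg ht.1] at hdeg
    have h2 := hmono ht.2
    rcases eq_or_lt_of_le hp.1 with h | h
    · have hlt : t.1.2 < s.1.2 := lt_of_le_of_ne ht.2 fun h' => hst (Seg.ext' h.symm h'.symm)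
      have := hmono' hlt
      omega
    · have := hmono' h
      omega

end Hook

/-! ### The rank-exact Grothendieck group of a finite poset -/

section RankSide

variable (F : Type u) [Field F] {P : Type} [PartialOrder P]

/-- The rank invariant on `K₀`. -/
noncomputable def rankHom : K0Rk F P →+ (Seg P → ℤ) :=
  K0.lift (rankExact F P) rk fun _ hS => hS.2

theorem rankHom_cls (M : Rep F P) : rankHom F (K0.cls (rankExact F P) M) = rk M :=
  K0.lift_cls ..

open Classical in
/-- The rank of `M p ⟶ M q` is `dim M p - dim ker (M p ⟶ M q)`, and both terms are dimensions of
spaces of morphisms out of hooks. -/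
theorem rk_eq_sub (M : Rep F P) (s : Seg P) :
    rk M s = (Module.finrank F (hook F (Seg.refl s.1.1) ⟶ M.obj) : ℤ) -
      if s.1.1 = s.1.2 then 0 else (Module.finrank F (hook F s ⟶ M.obj) : ℤ) := by
  rw [finrank_hook_hom_refl]
  by_cases hs : s.1.1 = s.1.2
  · obtain ⟨⟨p, q⟩, hpq⟩ := s
    obtain rfl : p = q := hs
    have : (M.obj.map (homOfLE hpq)).hom.hom = LinearMap.id :=
      LinearMap.ext fun m => map_self_apply F M.obj _ m
    have hr : LinearMap.range (M.obj.map (homOfLE hpq)).hom.hom = ⊤ := by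
      rw [this, LinearMap.range_id]
    rw [if_pos rfl, sub_zero]
    exact congrArg Nat.cast ((congrArg (fun W : Submodule F _ => Module.finrank F W) hr).trans
      (finrank_top F _))
  · rw [if_neg hs, finrank_hook_hom F hs, rk, eq_sub_iff_add_eq]
    exact_mod_cast LinearMap.finrank_range_add_finrank_ker _

variable [Finite P]

/-- A functor on a finite poset, as an object of `Rep F P`. -/
abbrev toRep (M : P ⥤ FGModuleCat.{u} F) : Rep F P := ⟨M, Set.toFinite _⟩

theorem isRelAdditive_rankExact :
    IsRelAdditive F (hook F (P := P)) fun M => K0.cls (rankExact F P) (toRep F M) := by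
  intro S hS hadd
  let S' : ShortComplex (Rep F P) :=
    { X₁ := toRep F S.X₁
      X₂ := toRep F S.X₂
      X₃ := toRep F S.X₃
      f := ObjectProperty.homMk S.f
      g := ObjectProperty.homMk S.g
      zero := ObjectProperty.hom_ext _ S.zero }
  refine K0.cls_add (rankExact F P) (S := S') ⟨hS, funext fun s => ?_⟩
  simp only [Pi.add_apply, rk_eq_sub, S', hadd]
  split_ifs <;> push_cast <;> ring

/-- The hooks generate the rank-exact Grothendieck group. -/
theorem closure_range_cls_hook :
    AddSubgroup.closure (Set.range fun s : Seg P =>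
      K0.cls (rankExact F P) (toRep F (hook F s))) = ⊤ := by
  have := finite_hook_hom F (P := P)
  exact K0.eq_top_of_cls_mem _ fun M => (isRelAdditive_rankExact F).mem_closure hookDegree
    (end_hook F) (fun s t hst hdeg => hook_hom_eq_zero F hst hdeg)
    (fun g hg => eq_zero_of_forall_hook_refl F g fun x => hg (Seg.refl x)) M.obj

theorem pi_eq_top_of_single_mem {κ : Type*} [Finite κ] [DecidableEq κ] (B : AddSubgroup (κ → ℤ))
    (hB : ∀ i, Pi.single i 1 ∈ B) : B = ⊤ := by
  have := Fintype.ofFinite κ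
  refine (AddSubgroup.eq_top_iff' B).2 fun x => ?_
  rw [← Finset.univ_sum_single x]
  refine B.sum_mem fun i _ => ?_
  rw [← mul_one (x i), ← smul_eq_mul, Pi.single_smul]
  exact B.zsmul_mem (hB i) _

open Classical in
theorem rk_indicatorRep (I : Set P) [I.OrdConnected] (s : Seg P) :
    rk (toRep F (indicatorRep F I)) s = if s.1.1 ∈ I ∧ s.1.2 ∈ I then 1 else 0 := by
  rw [rk, finrank_range_indicatorRep_map]
  split_ifs <;> simp

/-- The rank invariants of segment modules are unitriangular with respect to inclusion of
segments, so every integral function on segments is a combination of rank invariants. -/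
theorem closure_range_rk :
    AddSubgroup.closure (Set.range (rk : Rep F P → Seg P → ℤ)) = ⊤ := by
  classical
  have := Fintype.ofFinite (Seg P)
  refine pi_eq_top_of_single_mem _ ?_
  suffices H : ∀ (k : ℕ) (s : Seg P), (Set.Icc s.1.1 s.1.2).ncard = k →
      Pi.single s 1 ∈ AddSubgroup.closure (Set.range (rk : Rep F P → Seg P → ℤ)) from
    fun s => H _ s rfl
  intro k
  induction k using Nat.strong_induction_on with
  | _ k ih =>
    intro s hk
    -- The rank invariant of the segment module on `[p, q]` is the indicator of the segments
    -- contained in `[p, q]`.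
    let T : Finset (Seg P) := {t | t ≠ s ∧ t.1.1 ∈ Set.Icc s.1.1 s.1.2 ∧
      t.1.2 ∈ Set.Icc s.1.1 s.1.2}
    have key : Pi.single s 1 = rk (toRep F (indicatorRep F (Set.Icc s.1.1 s.1.2))) -
        ∑ t ∈ T, Pi.single t 1 := by
      funext x
      rw [Pi.sub_apply, rk_indicatorRep, Finset.sum_apply, Finset.sum_pi_single]
      by_cases hx : x = s
      · subst hx
        simp [T, x.2]
      · simp [T, hx]
    rw [key]
    refine AddSubgroup.sub_mem _ (AddSubgroup.subset_closure ⟨_, rfl⟩)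
      (AddSubgroup.sum_mem _ fun t ht => ?_)
    obtain ⟨hne, h1, h2⟩ := (Finset.mem_filter.1 ht).2
    refine ih _ ?_ t rfl
    rw [← hk]
    refine Set.ncard_lt_ncard ⟨Set.Icc_subset_Icc h1.1 h2.2, fun hsub => hne ?_⟩
    exact Seg.ext' (le_antisymm (hsub (Set.left_mem_Icc.2 s.2)).1 h1.1)
      (le_antisymm h2.2 (hsub (Set.right_mem_Icc.2 s.2)).2)

theorem rankHom_bijective : Function.Bijective (rankHom F : K0Rk F P →+ (Seg P → ℤ)) := by
  refine bijective_of_closure_range_eq_top _ (closure_range_cls_hook F) _ ?_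
  rw [← AddMonoidHom.range_eq_top, eq_top_iff, ← closure_range_rk F, AddSubgroup.closure_le]
  rintro _ ⟨M, rfl⟩
  exact ⟨_, rankHom_cls F M⟩

end RankSide

/-! ### The Grothendieck group of all representations of a finite poset -/

section DimensionSide

variable (F : Type u) [Field F] {P : Type} [PartialOrder P]

theorem finrank_obj_of_shortExact {S : ShortComplex (P ⥤ FGModuleCat.{u} F)} (hS : S.ShortExact)
    (x : P) :
    Module.finrank F (S.X₂.obj x) =
      Module.finrank F (S.X₁.obj x) + Module.finrank F (S.X₃.obj x) := by
  have h := (hS.map_of_exact ((evaluation P (FGModuleCat.{u} F)).obj x)).map_of_exact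
    (forget₂ (FGModuleCat.{u} F) (ModuleCat.{u} F))
  have h₁ : Module.Finite F (S.X₁.obj x) := inferInstance
  have h₃ : Module.Finite F (S.X₃.obj x) := inferInstance
  exact @ModuleCat.free_shortExact_finrank_add F _ _ h _ _ _ _ h₁ h₃ rfl rfl _

/-- The dimension vector on the Grothendieck group of all representations of a poset. -/
noncomputable def dimHom :
    K0 (fun S : ShortComplex (P ⥤ FGModuleCat.{u} F) => S.ShortExact) →+ (P → ℤ) :=
  K0.lift _ (fun M x => (Module.finrank F (M.obj x) : ℤ)) fun S hS => funext fun x => by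
    rw [finrank_obj_of_shortExact F hS x]
    push_cast
    rfl

theorem dimHom_cls (M : P ⥤ FGModuleCat.{u} F) (x : P) :
    dimHom F (K0.cls _ M) x = (Module.finrank F (M.obj x) : ℤ) :=
  congrFun (K0.lift_cls ..) x

variable [Finite P]

/-- The hooks of the segments `(x, x)`, that is, the indecomposable projectives, generate the
Grothendieck group of all representations. -/
theorem closure_range_cls_projective :
    AddSubgroup.closure (Set.range fun x : P =>
      K0.cls (fun S : ShortComplex (P ⥤ FGModuleCat.{u} F) => S.ShortExact)
        (hook F (Seg.refl x))) = ⊤ := by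
  have := fun x : P => finite_hook_hom F (Seg.refl x)
  have hadd : IsRelAdditive F (fun x : P => hook F (Seg.refl x))
      (K0.cls fun S : ShortComplex (P ⥤ FGModuleCat.{u} F) => S.ShortExact) :=
    fun S hS _ => K0.cls_add _ hS
  refine K0.eq_top_of_cls_mem _ fun M => hadd.mem_closure (fun x => hookDegree (Seg.refl x))
    (fun x => end_hook F _) (fun x y hxy hdeg => hook_hom_eq_zero F (fun h => hxy ?_) hdeg)
    (fun g hg => eq_zero_of_forall_hook_refl F g hg) M
  exact congrArg (fun s : Seg P => s.1.1) h

theorem dimHom_bijective : Function.Bijective (dimHom F (P := P)) := by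
  classical
  refine bijective_of_closure_range_eq_top _ (closure_range_cls_projective F) _ ?_
  rw [← AddMonoidHom.range_eq_top]
  refine pi_eq_top_of_single_mem _ fun x => ⟨K0.cls _ (indicatorRep F {x}), funext fun y => ?_⟩
  rw [dimHom_cls, finrank_indicatorRep_obj]
  simp [Pi.single_apply]

end DimensionSide

/-! ### Strata of the cubulation -/

section Strata

variable {d : ℕ} {n : Fin d → ℕ}

theorem Spine.ext_source_target {m : ℕ} {α β : Spine m} (hs : α.source = β.source)
    (ht : α.target = β.target) : α = β := by
  cases α <;> cases β <;>
    simp only [Spine.source, Spine.target, Fin.ext_iff, Fin.val_castSucc, Fin.val_succ,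
      Spine.vertex.injEq, Spine.edge.injEq, reduceCtorEq] at * <;> omega

theorem iota_injective : Function.Injective (iota (n := n)) := fun _ _ h =>
  funext fun k => Spine.ext_source_target (congrFun (congrArg (fun s => s.1.1) h) k)
    (congrFun (congrArg (fun s => s.1.2) h) k)

/-- The face order is antisymmetric: a cube determines its stratum. -/
instance : PartialOrder (Stratum n) where
  le_antisymm _ _ h h' := by
    rw [stratum_le_iff] at h h'
    exact funext fun k => Spine.ext_source_target (le_antisymm (h' k).1 (h k).1)
      (le_antisymm (h k).2 (h' k).2)

instance : Finite (Grid n) := inferInstanceAs (Finite (∀ k, Fin (n k + 1)))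

instance : Finite (Stratum n) := Finite.of_injective _ iota_injective

instance : Finite (Ent n) := inferInstanceAs (Finite (Stratum n))

end Strata

end GridK

theorem mainTheorem4 (F : Type u) [Field F] (d : ℕ) (n : Fin d → ℕ) :
    Function.Injective (GridK.iota (n := n)) ∧
    ∃ (rank : GridK.K0Rk F (GridK.Grid n) ≃+ (GridK.Seg (GridK.Grid n) → ℤ))
      (dim : GridK.K0PMod n F ≃+ (GridK.Stratum n → ℤ)),
      (∀ M : GridK.Rep F (GridK.Grid n), rank (GridK.K0.cls _ M) = GridK.rk M) ∧
      (∀ (N : GridK.PMod n (FGModuleCat.{u} F)) (σ : GridK.Stratum n),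
        dim (GridK.K0.cls _ N) σ = (Module.finrank F (N.obj (OrderDual.toDual σ)) : ℤ)) ∧
      ∃ π : GridK.K0Rk F (GridK.Grid n) →+ GridK.K0PMod n F,
        (∀ x, dim (π x) = rank x ∘ GridK.iota) ∧ Function.Surjective π := by
  let rank := AddEquiv.ofBijective _ (GridK.rankHom_bijective F (P := GridK.Grid n))
  let dim : GridK.K0PMod n F ≃+ (GridK.Stratum n → ℤ) :=
    AddEquiv.ofBijective _ (GridK.dimHom_bijective F (P := GridK.Ent n))
  let res : (GridK.Seg (GridK.Grid n) → ℤ) →+ (GridK.Stratum n → ℤ) :=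
    (LinearMap.funLeft ℤ ℤ (GridK.iota (n := n))).toAddMonoidHom
  have hres : Function.Surjective res :=
    LinearMap.funLeft_surjective_of_injective ℤ ℤ _ GridK.iota_injective
  refine ⟨GridK.iota_injective, rank, dim, GridK.rankHom_cls F, fun N σ => ?_,
    (dim.symm.toAddMonoidHom.comp res).comp rank.toAddMonoidHom, fun x => ?_, ?_⟩
  · exact GridK.dimHom_cls F N (OrderDual.toDual σ)
  · exact dim.apply_symm_apply _
  · exact (dim.symm.surjective.comp hres).comp rank.surjective
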